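/- Let $\Omega\subset\mathbb{R}^N$ be an open set and let $p\in(1,\infty)$. Let $W^{1,p}(\Omega)$ be the space of all $u\in L^p(\Omega)$ (real-valued, Lebesgue measure) whose first-order distributional partial derivatives $\partial_1u,\dots,\partial_Nu$ belong to $L^p(\Omega)$, with the norm given by $$\|u\|_{W^{1,p}(\Omega)}^p=\|u\|_{L^p(\Omega)}^p+\sum_{i=1}^N\|\partial_iu\|_{L^p(\Omega)}^p ,$$ and let $\tilde W^{1,p}(\Omega)$ be the closure in $W^{1,p}(\Omega)$ of the set of those elements of $W^{1,p}(\Omega)$ that are restrictions $f|_\Omega$ of continuous functions $f:\overline\Omega\to\mathbb{R}$ with compact support. For an arbitrary set $A\subset\overline\Omega$ define the relative $p$-capacity $$\mathrm{Cap}_{p,\Omega}(A)=\inf\Big\{\|u\|^p_{W^{1,p}(\Omega)}: u\in\tilde W^{1,p}(\Omega),\ \text{there is } O\supset A \text{ open in }\overline\Omega\text{ with } u\ge 1\text{ a.e. on }O\cap\Omega\Big\}\in[0,\infty],$$ where $\inf\emptyset=\infty$. Then $\mathrm{Cap}_{p,\Omega}$ is a normed Choquet capacity on the topological space $\overline\Omega$,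 that is: (C0) $\mathrm{Cap}_{p,\Omega}(\emptyset)=0$; (C1) $A\subset B\subset\overline\Omega$ implies $\mathrm{Cap}_{p,\Omega}(A)\le\mathrm{Cap}_{p,\Omega}(B)$; (C2) for every increasing sequence $(A_n)_n$ of arbitrary subsets of $\overline\Omega$, $\lim_n\mathrm{Cap}_{p,\Omega}(A_n)=\mathrm{Cap}_{p,\Omega}\big(\bigcup_nA_n\big)$; (C3) for every decreasing sequence $(K_n)_n$ of compact subsets of $\overline\Omega$, $\lim_n\mathrm{Cap}_{p,\Omega}(K_n)=\mathrm{Cap}_{p,\Omega}\big(\bigcap_nK_n\big)$. Moreover, for every $A\subset\overline\Omega$, $$\mathrm{Cap}_{p,\Omega}(A)=\inf\{\mathrm{Cap}_{p,\Omega}(O): O\text{ is open in }\overline\Omega\text{ and }A\subset O\}.$$ -/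

import Mathlib

open MeasureTheory Filter Topology TopologicalSpace

namespace RelCap

/-- The space `ℝ^N` with its Euclidean norm and Lebesgue measure. -/
abbrev RN (N : ℕ) : Type := EuclideanSpace ℝ (Fin N)

/-- `L^p(Ω)`: classes of `p`-integrable functions for Lebesgue measure on `Ω`. -/
abbrev LpOn {N : ℕ} (p : ℝ) (Ω : Opens (RN N)) : Type :=
  Lp ℝ (ENNReal.ofReal p) (volume.restrict (Ω : Set (RN N)))

/-- `g` is the `i`-th partial derivative of `u` in the sense of distributions on `Ω`:
`∫_Ω u ∂_i φ = - ∫_Ω g φ` for every test function `φ ∈ 𝒟(Ω)`. -/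
def HasWeakPartial {N : ℕ} {p : ℝ} {Ω : Opens (RN N)} (i : Fin N) (u g : LpOn p Ω) : Prop :=
  ∀ φ : TestFunction Ω ℝ ⊤,
    ∫ x in (Ω : Set (RN N)), u x * fderiv ℝ φ x (EuclideanSpace.single i 1)
      = - ∫ x in (Ω : Set (RN N)), g x * φ x

/-- The Sobolev space `W^{1,p}(Ω)`, as a set of elements of `L^p(Ω)`. -/
def W1p {N : ℕ} (p : ℝ) (Ω : Opens (RN N)) : Set (LpOn p Ω) :=
  {u | ∀ i : Fin N, ∃ g : LpOn p Ω, HasWeakPartial i u g}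

open Classical in
/-- The `i`-th weak partial derivative of `u` in `L^p(Ω)` (with value `0` if there is none).
For `1 ≤ p` it is unique, see `HasWeakPartial.unique`. -/
noncomputable def weakPartial {N : ℕ} {p : ℝ} {Ω : Opens (RN N)} (i : Fin N) (u : LpOn p Ω) :
    LpOn p Ω :=
  if h : ∃ g : LpOn p Ω, HasWeakPartial i u g then h.choose else 0

/-- `‖u‖^p_{W^{1,p}(Ω)} = ‖u‖_p^p + ∑_i ‖∂_i u‖_p^p`. -/
noncomputable def sobolevNormPow {N : ℕ} {p : ℝ} {Ω : Opens (RN N)} (u : LpOn p Ω) : ℝ :=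
  ‖u‖ ^ p + ∑ i : Fin N, ‖weakPartial i u‖ ^ p

/-- The norm of `W^{1,p}(Ω)`. -/
noncomputable def sobolevNorm {N : ℕ} {p : ℝ} {Ω : Opens (RN N)} (u : LpOn p Ω) : ℝ :=
  sobolevNormPow u ^ (1 / p)

/-- `W^{1,p}(Ω) ∩ C_c(closure Ω)`: the elements of `W^{1,p}(Ω)` that are the restriction to `Ω`
of a continuous function with compact support on the closure of `Ω`. -/
def W1pCc {N : ℕ} (p : ℝ) (Ω : Opens (RN N)) : Set (LpOn p Ω) :=
  {u | u ∈ W1p p Ω ∧ ∃ f : CompactlySupportedContinuousMap (closure (Ω : Set (RN N))) ℝ,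
    ∀ᵐ x ∂(volume.restrict (Ω : Set (RN N))),
      ∀ hx : x ∈ closure (Ω : Set (RN N)), u x = f ⟨x, hx⟩}

/-- The closure of `W^{1,p}(Ω) ∩ C_c(closure Ω)` in `W^{1,p}(Ω)`. -/
def W1pTilde {N : ℕ} (p : ℝ) (Ω : Opens (RN N)) : Set (LpOn p Ω) :=
  {u | u ∈ W1p p Ω ∧ ∀ ε : ℝ, 0 < ε → ∃ v ∈ W1pCc p Ω, sobolevNorm (u - v) < ε}

/-- The admissible functions for `A ⊆ closure Ω`: those `u` in `W1pTilde p Ω` with `u ≥ 1` a.e. on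
`O ∩ Ω` for some relatively open `O ⊆ closure Ω` containing `A`. -/
def admissible {N : ℕ} (p : ℝ) (Ω : Opens (RN N)) (A : Set (closure (Ω : Set (RN N)))) :
    Set (LpOn p Ω) :=
  {u | u ∈ W1pTilde p Ω ∧ ∃ O : Set (closure (Ω : Set (RN N))), IsOpen O ∧ A ⊆ O ∧
    ∀ᵐ x ∂(volume.restrict (Ω : Set (RN N))), x ∈ Subtype.val '' O → 1 ≤ u x}

/-- The relative `p`-capacity of a subset of the closure of `Ω`; it is `⊤` if there is no admissible
function. -/
noncomputable def relCap {N : ℕ} (p : ℝ) (Ω : Opens (RN N))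
    (A : Set (closure (Ω : Set (RN N)))) : EReal :=
  sInf ((fun u : LpOn p Ω => ((sobolevNormPow u : ℝ) : EReal)) '' admissible p Ω A)

/-- A Choquet capacity on a topological space. -/
structure IsChoquetCapacity {T : Type*} [TopologicalSpace T] (C : Set T → EReal) : Prop where
  mono : ∀ A B : Set T, A ⊆ B → C A ≤ C B
  tendsto_iUnion : ∀ A : ℕ → Set T, (∀ n, A n ⊆ A (n + 1)) →
    Tendsto (fun n => C (A n)) atTop (𝓝 (C (⋃ n, A n)))
  tendsto_iInter : ∀ K : ℕ → Set T, (∀ n, K (n + 1) ⊆ K n) → (∀ n, IsCompact (K n)) →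
    Tendsto (fun n => C (K n)) atTop (𝓝 (C (⋂ n, K n)))

/-- A normed Choquet capacity: a Choquet capacity that vanishes on the empty set. -/
structure IsNormedChoquetCapacity {T : Type*} [TopologicalSpace T] (C : Set T → EReal) : Prop
    extends IsChoquetCapacity C where
  empty : C ∅ = 0

/-- Weak partial derivatives in `L^p(Ω)` are unique. -/
theorem HasWeakPartial.unique {N : ℕ} {p : ℝ} (hp : 1 ≤ p) {Ω : Opens (RN N)} {i : Fin N}
    {u g h : LpOn p Ω} (hg : HasWeakPartial i u g) (hh : HasWeakPartial i u h) : g = h := by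
  have hp1 : (1 : ENNReal) ≤ ENNReal.ofReal p := by simpa using ENNReal.ofReal_le_ofReal hp
  have hloc : ∀ w : LpOn p Ω, LocallyIntegrable w (volume.restrict (Ω : Set (RN N))) :=
    fun w => (Lp.memLp w).locallyIntegrable hp1
  have hint : ∀ (w : LpOn p Ω) (φ : RN N → ℝ), Continuous φ → HasCompactSupport φ →
      Integrable (fun x => φ x • w x) (volume.restrict (Ω : Set (RN N))) :=
    fun w φ hc hs => (hloc w).integrable_smul_left_of_hasCompactSupport hc hs
  have key : ∀ᵐ x ∂(volume.restrict (Ω : Set (RN N))), x ∈ (Ω : Set (RN N)) → (g x - h x) = 0 := by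
    refine Ω.isOpen.ae_eq_zero_of_integral_contDiff_smul_eq_zero
      (((hloc g).sub (hloc h)).locallyIntegrableOn _) ?_
    intro φ hφ hs ht
    have h1 := (hg ⟨φ, hφ, hs, ht⟩).symm.trans (hh ⟨φ, hφ, hs, ht⟩)
    have h2 : ∫ x in (Ω : Set (RN N)), φ x • g x = ∫ x in (Ω : Set (RN N)), φ x • h x := by
      simpa [mul_comm] using h1
    simp only [smul_sub]
    rw [integral_sub (hint g φ hφ.continuous hs) (hint h φ hφ.continuous hs), h2, sub_self]
  refine Lp.ext ?_
  filter_upwards [key, ae_restrict_mem Ω.isOpen.measurableSet] with x hx hm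
  exact sub_eq_zero.mp (hx hm)

end RelCap

/-! Monotonicity, the value on the empty set, outer regularity and (C3) are formal: a function
admissible for `A` is admissible for a whole open neighbourhood of `A`, and decreasing compact sets
eventually enter any neighbourhood of their intersection. The analysis is in (C2).

Suppose every `A n` has capacity at most `c`, and put `r = c ^ (1 / p)`. The admissible sets are
convex and decrease with `n`, and each contains functions of norm arbitrarily close to `r`. Uniform
convexity (`UniformlyConvexPow.exists_tendsto`) yields admissible `z n` converging in norm to some
`w` with `‖w‖ ≤ r`. The limit itself need not be at least 1 near the union. Along a rapidly
convergent subsequence, however, `z (σ 0) + ∑ |z (σ (n + 1)) - z (σ n)|` dominates every `z (σ m)`,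
hence is admissible for the union, and its norm is at most `‖w‖ + ε`
(`exists_mem_admissibleGraph_iUnion`).

This needs absolute values to stay in the closure of `W^{1,p} ∩ C_c` without increasing the norm
(`exists_abs_mem`). For continuous functions one composes with `√(t² + δ²) - δ`, using a chain rule
for weak derivatives, and lets `δ → 0`; a Mazur-type argument
(`UniformlyConvexPow.exists_mem_of_tendsto`) replaces weak compactness. All of this takes place
among tuples `(u, ∂₁u, …, ∂_Nu)`, where the Sobolev space is a closed subspace of an `ℓ^p` sum of
`L^p` spaces. -/

namespace RelCap

/-! ### Uniform convexity of `L^p` and convergent selections -/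

/-- Strict midpoint convexity of `|·| ^ p`. -/
theorem abs_midpoint_rpow_lt {p : ℝ} (hp : 1 < p) {a b : ℝ} (hab : a ≠ b) :
    |(a + b) / 2| ^ p < (|a| ^ p + |b| ^ p) / 2 := by
  have hp0 : 0 < p := by linarith
  have htri : |(a + b) / 2| ≤ (|a| + |b|) / 2 := by
    rw [abs_div, abs_two]; gcongr; exact abs_add_le a b
  -- Strict convexity of `t ^ p` on `[0, ∞)` says nothing when the moduli agree; there `b = -a` and
  -- the midpoint vanishes.
  by_cases h : |a| = |b|
  · have hb : b = -a := by
      rcases abs_eq_abs.mp h with h | h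
      · exact absurd h hab
      · linarith
    have ha : a ≠ 0 := by
      rintro rfl; apply hab; simpa using hb.symm
    have : 0 < |a| ^ p := Real.rpow_pos_of_pos (abs_pos.mpr ha) p
    subst hb
    simp [Real.zero_rpow hp0.ne']
    exact this
  · have h1 := (strictConvexOn_rpow hp).2 (Set.mem_Ici.mpr (abs_nonneg a))
      (Set.mem_Ici.mpr (abs_nonneg b)) h (by norm_num : (0 : ℝ) < 1 / 2)
      (by norm_num : (0 : ℝ) < 1 / 2) (by norm_num)
    simp only [smul_eq_mul] at h1
    calc |(a + b) / 2| ^ p ≤ ((|a| + |b|) / 2) ^ p :=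
          Real.rpow_le_rpow (abs_nonneg _) htri hp0.le
      _ = (1 / 2 * |a| + 1 / 2 * |b|) ^ p := by congr 1; ring
      _ < _ := h1
      _ = _ := by ring

/-- A uniform convexity inequality for `|·| ^ p`. -/
theorem exists_abs_sub_rpow_le {p : ℝ} (hp : 1 < p) {ε : ℝ} (hε : 0 < ε) :
    ∃ C : ℝ, 0 ≤ C ∧ ∀ a b : ℝ, |a - b| ^ p ≤
      ε * (|a| ^ p + |b| ^ p) + C * ((|a| ^ p + |b| ^ p) / 2 - |(a + b) / 2| ^ p) := by
  have hp0 : 0 < p := by linarith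
  have hcont : Continuous fun t : ℝ => |t| ^ p :=
    (Real.continuous_rpow_const hp0.le).comp continuous_abs
  have hD : Continuous fun x : ℝ × ℝ => (|x.1| ^ p + |x.2| ^ p) / 2 - |(x.1 + x.2) / 2| ^ p :=
    (((hcont.comp continuous_fst).add (hcont.comp continuous_snd)).div_const 2).sub
      (hcont.comp ((continuous_fst.add continuous_snd).div_const 2))
  have hle1 : ∀ {a b : ℝ}, |a| ^ p + |b| ^ p = 1 → |a| ≤ 1 := by
    intro a b h
    by_contra! hlt
    have h1 : 1 < |a| ^ p := Real.one_lt_rpow hlt hp0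
    have h2 : 0 ≤ |b| ^ p := by positivity
    linarith
  -- By homogeneity only pairs with `|a| ^ p + |b| ^ p = 1` matter. Among these, the ones violating
  -- the bound by `ε` form a compact set, on which the convexity defect has a positive lower bound
  -- `δ`; since `|a - b| ^ p ≤ 2 ^ p` there, `C = 2 ^ p / δ` works.
  let S : Set (ℝ × ℝ) := {x | |x.1| ^ p + |x.2| ^ p = 1 ∧ ε ≤ |x.1 - x.2| ^ p}
  have hS : IsCompact S := by
    refine IsCompact.of_isClosed_subset ((isCompact_Icc (a := (-1 : ℝ)) (b := 1)).prod
      (isCompact_Icc (a := (-1 : ℝ)) (b := 1))) ?_ ?_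
    · exact (isClosed_eq ((hcont.comp continuous_fst).add (hcont.comp continuous_snd))
        continuous_const).inter
        (isClosed_le continuous_const (hcont.comp (continuous_fst.sub continuous_snd)))
    · rintro ⟨a, b⟩ ⟨h, -⟩
      exact ⟨abs_le.mp (hle1 h), abs_le.mp (hle1 ((add_comm _ _).trans h))⟩
  obtain ⟨δ, hδ, hδS⟩ := hS.exists_forall_le' hD.continuousOn (a := 0) (by
    rintro ⟨a, b⟩ ⟨-, h⟩
    have hab : a ≠ b := by
      rintro rfl
      simp [Real.zero_rpow hp0.ne'] at h
      linarith
    have := abs_midpoint_rpow_lt hp hab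
    simp only
    linarith)
  have hDnn : ∀ a b : ℝ, 0 ≤ (|a| ^ p + |b| ^ p) / 2 - |(a + b) / 2| ^ p := by
    intro a b
    by_cases hab : a = b
    · subst hab; simp
    · have := abs_midpoint_rpow_lt hp hab
      linarith
  refine ⟨2 ^ p / δ, by positivity, ?_⟩
  have hunit : ∀ a b : ℝ, |a| ^ p + |b| ^ p = 1 → |a - b| ^ p ≤
      ε + 2 ^ p / δ * ((|a| ^ p + |b| ^ p) / 2 - |(a + b) / 2| ^ p) := by
    intro a b h
    by_cases hlt : ε ≤ |a - b| ^ p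
    · have h1 := hδS (a, b) ⟨h, hlt⟩
      simp only at h1
      have h2 : |a - b| ^ p ≤ 2 ^ p := by
        refine Real.rpow_le_rpow (abs_nonneg _) ?_ hp0.le
        have := abs_sub a b
        have := hle1 h
        have := hle1 ((add_comm _ _).trans h)
        linarith
      have h3 : (2 : ℝ) ^ p = 2 ^ p / δ * δ := by field_simp
      have h4 : 2 ^ p / δ * δ ≤ 2 ^ p / δ * ((|a| ^ p + |b| ^ p) / 2 - |(a + b) / 2| ^ p) := by
        gcongr
      linarith
    · have h1 : 0 ≤ 2 ^ p / δ * ((|a| ^ p + |b| ^ p) / 2 - |(a + b) / 2| ^ p) :=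
        mul_nonneg (by positivity) (hDnn a b)
      linarith
  intro a b
  have ha : 0 ≤ |a| ^ p := by positivity
  have hb : 0 ≤ |b| ^ p := by positivity
  rcases (add_nonneg ha hb).eq_or_lt with hs | hs
  · have hz : ∀ c : ℝ, |c| ^ p = 0 → c = 0 := by
      intro c hc
      simpa using (Real.rpow_eq_zero (abs_nonneg c) hp0.ne').mp hc
    have ha0 := hz a (by linarith)
    have hb0 := hz b (by linarith)
    subst ha0 hb0
    simp [Real.zero_rpow hp0.ne']
  · set s := |a| ^ p + |b| ^ p with hsdef
    have hr : 0 < s ^ (1 / p) := Real.rpow_pos_of_pos hs _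
    have hscale : ∀ c : ℝ, |c / s ^ (1 / p)| ^ p = |c| ^ p / s := by
      intro c
      rw [abs_div, Real.div_rpow (abs_nonneg _) (abs_nonneg _), abs_of_pos hr,
        ← Real.rpow_mul hs.le, one_div_mul_cancel hp0.ne', Real.rpow_one]
    have h := hunit (a / s ^ (1 / p)) (b / s ^ (1 / p)) (by
      rw [hscale, hscale, ← add_div, ← hsdef, div_self hs.ne'])
    rw [← sub_div, ← add_div, div_right_comm _ _ (2 : ℝ), hscale, hscale, hscale, hscale,
      ← add_div, ← hsdef] at h
    have h' := mul_le_mul_of_nonneg_left h hs.le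
    have e1 : s * (|a - b| ^ p / s) = |a - b| ^ p := by field_simp
    have e2 : s * (ε + 2 ^ p / δ * (s / s / 2 - |(a + b) / 2| ^ p / s)) =
      ε * s + 2 ^ p / δ * (s / 2 - |(a + b) / 2| ^ p) := by field_simp
    rwa [e1, e2] at h'

theorem integrable_abs_rpow {α : Type*} [MeasurableSpace α] {μ : Measure α} {p : ℝ} (hp : 0 < p)
    (f : Lp ℝ (ENNReal.ofReal p) μ) : Integrable (fun x => |f x| ^ p) μ := by
  have := (Lp.memLp f).integrable_norm_rpow (by simpa using hp) ENNReal.ofReal_ne_top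
  simpa [ENNReal.toReal_ofReal hp.le] using this

theorem Lp_norm_rpow_eq_integral {α : Type*} [MeasurableSpace α] {μ : Measure α} {p : ℝ}
    (hp : 0 < p) (f : Lp ℝ (ENNReal.ofReal p) μ) : ‖f‖ ^ p = ∫ x, |f x| ^ p ∂μ := by
  have hnn : 0 ≤ ∫ x, |f x| ^ p ∂μ := integral_nonneg fun x => by positivity
  rw [Lp.norm_def, (Lp.memLp f).eLpNorm_eq_integral_rpow_norm (by simpa using hp)
    ENNReal.ofReal_ne_top]
  simp only [ENNReal.toReal_ofReal hp.le, Real.norm_eq_abs]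
  rw [ENNReal.toReal_ofReal (by positivity), ← Real.rpow_mul hnn, inv_mul_cancel₀ hp.ne',
    Real.rpow_one]

/-- The norm satisfies a uniform convexity inequality with exponent `p`. -/
def UniformlyConvexPow (p : ℝ) (E : Type*) [NormedAddCommGroup E] [NormedSpace ℝ E] : Prop :=
  ∀ ε : ℝ, 0 < ε → ∃ C : ℝ, 0 ≤ C ∧ ∀ x y : E, ‖x - y‖ ^ p ≤
    ε * (‖x‖ ^ p + ‖y‖ ^ p) +
      C * ((‖x‖ ^ p + ‖y‖ ^ p) / 2 - ‖(2⁻¹ : ℝ) • (x + y)‖ ^ p)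

/-- The `p`-th power of the norm is a sum of integrals of `|·| ^ p`, so the scalar inequality can be
integrated and summed term by term. This is what the formulation in `p`-th powers, instead of a
modulus of convexity, is for. -/
theorem uniformlyConvexPow_piLp {α ι : Type*} [MeasurableSpace α] [Fintype ι] (μ : Measure α)
    {p : ℝ} (hp : 1 < p) [Fact (1 ≤ ENNReal.ofReal p)] :
    UniformlyConvexPow p
      (PiLp (ENNReal.ofReal p) fun _ : ι => Lp ℝ (ENNReal.ofReal p) μ) := by
  have hp0 : 0 < p := by linarith
  have hnorm : ∀ x : PiLp (ENNReal.ofReal p) fun _ : ι => Lp ℝ (ENNReal.ofReal p) μ,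
      ‖x‖ ^ p = ∑ j, ∫ t, |x j t| ^ p ∂μ := by
    intro x
    rw [PiLp.norm_eq_sum (by simpa [ENNReal.toReal_ofReal hp0.le] using hp0)]
    simp only [ENNReal.toReal_ofReal hp0.le]
    rw [← Real.rpow_mul (Finset.sum_nonneg fun _ _ => by positivity), one_div_mul_cancel hp0.ne',
      Real.rpow_one]
    exact Finset.sum_congr rfl fun j _ => Lp_norm_rpow_eq_integral hp0 _
  intro ε hε
  obtain ⟨C, hC, h⟩ := exists_abs_sub_rpow_le hp hε
  refine ⟨C, hC, fun x y => ?_⟩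
  simp only [hnorm]
  rw [← Finset.sum_add_distrib, Finset.mul_sum, Finset.sum_div, ← Finset.sum_sub_distrib,
    Finset.mul_sum, ← Finset.sum_add_distrib]
  refine Finset.sum_le_sum fun j _ => ?_
  have hx := integrable_abs_rpow hp0 (x j)
  have hy := integrable_abs_rpow hp0 (y j)
  have hm := integrable_abs_rpow hp0 (((2⁻¹ : ℝ) • (x + y)) j)
  have hs := integrable_abs_rpow hp0 ((x - y) j)
  rw [← integral_add hx hy, ← integral_const_mul, ← integral_div, ← integral_sub,
    ← integral_const_mul, ← integral_add]
  rotate_left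
  · exact (hx.add hy).const_mul _
  · exact (((hx.add hy).div_const 2).sub hm).const_mul _
  · exact (hx.add hy).div_const 2
  · exact hm
  refine integral_mono_ae hs (((hx.add hy).const_mul _).add
    ((((hx.add hy).div_const 2).sub hm).const_mul _)) ?_
  filter_upwards [Lp.coeFn_sub (x j) (y j), Lp.coeFn_smul (2⁻¹ : ℝ) (x j + y j),
    Lp.coeFn_add (x j) (y j)] with t h1 h2 h3
  have e1 : (x - y) j t = x j t - y j t := h1
  have e2 : ((2⁻¹ : ℝ) • (x + y)) j t = (x j t + y j t) / 2 := by
    refine Eq.trans h2 ?_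
    rw [Pi.smul_apply, h3, Pi.add_apply, smul_eq_mul]; ring
  simp only [e1, e2]
  exact h (x j t) (y j t)

/-- In a uniformly convex Banach space, a decreasing sequence of convex sets that all come
`r`-close to the origin admits a convergent selection with limit of norm at most `r`. -/
theorem UniformlyConvexPow.exists_tendsto {p : ℝ} (hp : 1 < p) {E : Type*} [NormedAddCommGroup E]
    [NormedSpace ℝ E] [CompleteSpace E] (hE : UniformlyConvexPow p E) {K : ℕ → Set E}
    (hK : Antitone K) (hconv : ∀ n, Convex ℝ (K n)) {r : ℝ} (hr : 0 ≤ r)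
    (hne : ∀ n, ∀ ε > 0, ∃ x ∈ K n, ‖x‖ ≤ r + ε) :
    ∃ z : ℕ → E, ∃ w : E, (∀ n, z n ∈ K n) ∧ Tendsto z atTop (𝓝 w) ∧ ‖w‖ ≤ r := by
  have hp0 : 0 < p := by linarith
  -- These infima increase and are bounded by `r ^ p`, hence converge. Near-minimisers `z k`, `z n`
  -- with `k ≥ n` have their midpoint in `K n`, so their convexity defect is controlled by `M - m
  -- n`, and they form a Cauchy sequence.
  let m : ℕ → ℝ := fun n => sInf ((fun x => ‖x‖ ^ p) '' K n)
  have hbdd : ∀ n, BddBelow ((fun x : E => ‖x‖ ^ p) '' K n) := fun n =>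
    ⟨0, by rintro _ ⟨x, -, rfl⟩; positivity⟩
  have hKne : ∀ n, ((fun x : E => ‖x‖ ^ p) '' K n).Nonempty := fun n => by
    obtain ⟨x, hx, -⟩ := hne n 1 one_pos
    exact ⟨_, x, hx, rfl⟩
  have hmle : ∀ n, ∀ x ∈ K n, m n ≤ ‖x‖ ^ p := fun n x hx => csInf_le (hbdd n) ⟨x, hx, rfl⟩
  have hmono : Monotone m := fun a b hab =>
    csInf_le_csInf (hbdd a) (hKne b) (Set.image_mono (hK hab))
  have hmr : ∀ n, m n ≤ r ^ p := by
    intro n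
    have ht : Tendsto (fun ε : ℝ => (r + ε) ^ p) (𝓝[>] 0) (𝓝 (r ^ p)) := by
      have : Continuous fun ε : ℝ => (r + ε) ^ p :=
        (Real.continuous_rpow_const hp0.le).comp (continuous_const.add continuous_id)
      simpa using (this.tendsto 0).mono_left nhdsWithin_le_nhds
    refine ge_of_tendsto ht ?_
    filter_upwards [self_mem_nhdsWithin] with ε hε
    obtain ⟨x, hx, hxr⟩ := hne n ε hε
    exact (hmle n x hx).trans (Real.rpow_le_rpow (norm_nonneg _) hxr hp0.le)
  obtain ⟨M, hM⟩ : ∃ M, Tendsto m atTop (𝓝 M) :=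
    ⟨_, tendsto_atTop_ciSup hmono ⟨r ^ p, by rintro _ ⟨n, rfl⟩; exact hmr n⟩⟩
  have hmM : ∀ n, m n ≤ M := fun n => hmono.ge_of_tendsto hM n
  have hMr : M ≤ r ^ p := le_of_tendsto' hM hmr
  have hm0 : ∀ n, 0 ≤ m n := fun n => le_csInf (hKne n) (by rintro _ ⟨x, -, rfl⟩; positivity)
  have hz : ∀ n : ℕ, ∃ x ∈ K n, ‖x‖ ^ p < m n + 1 / ((n : ℝ) + 1) := by
    intro n
    obtain ⟨_, ⟨x, hx, rfl⟩, h⟩ := exists_lt_of_csInf_lt (hKne n)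
      (show m n < m n + 1 / ((n : ℝ) + 1) by have : 0 < 1 / ((n : ℝ) + 1) := by positivity
                                             linarith)
    exact ⟨x, hx, h⟩
  choose z hzK hzm using hz
  have hone : Tendsto (fun n : ℕ => 1 / ((n : ℝ) + 1)) atTop (𝓝 0) :=
    tendsto_one_div_add_atTop_nhds_zero_nat
  have hcauchy : CauchySeq z := by
    rw [Metric.cauchySeq_iff']
    intro η hη
    have hηp : 0 < η ^ p := Real.rpow_pos_of_pos hη p
    have hM0 : 0 ≤ M := (hm0 0).trans (hmM 0)
    -- The two `p`-th powers add up to at most `2 * (M + 1)`, so this `ε` contributes at most `η ^ p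
    -- / 2`.
    set ε := η ^ p / (4 * (M + 1)) with hεdef
    have hε : 0 < ε := by positivity
    obtain ⟨C, hC, h⟩ := hE ε hε
    have hlim : Tendsto (fun n => C * ((M - m n) / 2 + 1 / ((n : ℝ) + 1))) atTop (𝓝 0) := by
      have := ((((tendsto_const_nhds (x := M)).sub hM).div_const 2).add hone).const_mul C
      simpa using this
    obtain ⟨n, hn⟩ := (hlim.eventually (gt_mem_nhds (half_pos hηp))).exists
    refine ⟨n, fun k hk => ?_⟩
    have hkn : 1 / ((k : ℝ) + 1) ≤ 1 / ((n : ℝ) + 1) := by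
      have : (n : ℝ) ≤ k := by exact_mod_cast hk
      gcongr
    have hn1 : 1 / ((n : ℝ) + 1) ≤ 1 := by
      rw [div_le_one (by positivity)]; linarith [(Nat.cast_nonneg n : (0 : ℝ) ≤ n)]
    have hmid : m n ≤ ‖(2⁻¹ : ℝ) • (z k + z n)‖ ^ p := by
      apply hmle
      rw [smul_add]
      exact hconv n (hK hk (hzK k)) (hzK n) (by norm_num) (by norm_num) (by norm_num)
    have h1 := h (z k) (z n)
    have h2 : ‖z k‖ ^ p + ‖z n‖ ^ p ≤ 2 * (M + 1) := by
      linarith [hzm k, hzm n, hmM k, hmM n]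
    have h3 : ε * (‖z k‖ ^ p + ‖z n‖ ^ p) ≤ η ^ p / 2 := by
      calc _ ≤ ε * (2 * (M + 1)) := by gcongr
        _ = η ^ p / 2 := by rw [hεdef]; field_simp; ring
    have h4 : C * ((‖z k‖ ^ p + ‖z n‖ ^ p) / 2 - ‖(2⁻¹ : ℝ) • (z k + z n)‖ ^ p) ≤
        C * ((M - m n) / 2 + 1 / ((n : ℝ) + 1)) := by
      gcongr
      linarith [hzm k, hzm n, hmM k, hmM n]
    rw [dist_eq_norm]
    exact (Real.rpow_lt_rpow_iff (norm_nonneg _) hη.le hp0).mp (by linarith)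
  obtain ⟨w, hw⟩ := cauchySeq_tendsto_of_complete hcauchy
  refine ⟨z, w, hzK, hw, ?_⟩
  have h1 : Tendsto (fun n => ‖z n‖ ^ p) atTop (𝓝 (‖w‖ ^ p)) :=
    ((Real.continuous_rpow_const hp0.le).tendsto _).comp hw.norm
  have h2 : ‖w‖ ^ p ≤ M + 0 := le_of_tendsto_of_tendsto' h1 (hM.add hone) fun n => (hzm n).le
  exact (Real.rpow_le_rpow_iff (norm_nonneg _) hr hp0).mp (by linarith)

/-! ### Mollification and the chain rule for weak derivatives -/

open ContinuousLinearMap Function in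
/-- Averaging against an even kernel is a symmetric operation. -/
theorem integral_mul_convolution {N : ℕ} {ρ f c : RN N → ℝ} (hρ : Continuous ρ)
    (hρs : HasCompactSupport ρ) (hρe : ∀ x, ρ (-x) = ρ x) (hf : Continuous f) (hc : Continuous c)
    (hcs : HasCompactSupport c) :
    ∫ x, f x * (convolution ρ c (lsmul ℝ ℝ) volume) x =
      ∫ x, (convolution ρ f (lsmul ℝ ℝ) volume) x * c x := by
  simp only [convolution_lsmul_swap, smul_eq_mul, ← integral_const_mul, ← integral_mul_const]
  rw [integral_integral_swap_of_hasCompactSupport]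
  · refine integral_congr_ae (Eventually.of_forall fun y => ?_)
    refine integral_congr_ae (Eventually.of_forall fun x => ?_)
    simp only
    rw [← hρe (x - y), neg_sub]; ring
  · fun_prop
  · refine HasCompactSupport.intro ((hcs.isCompact.add hρs.isCompact).prod hcs.isCompact) ?_
    rintro ⟨x, y⟩ hxy
    simp only [uncurry]
    by_cases hy : y ∈ tsupport c
    · have : x - y ∉ tsupport ρ := fun h => hxy ⟨⟨y, hy, x - y, h, by simp⟩, hy⟩
      rw [image_eq_zero_of_notMem_tsupport this]; ring
    · rw [image_eq_zero_of_notMem_tsupport hy]; ring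

open ContinuousLinearMap in
theorem abs_normed_convolution_le {N : ℕ} (ρ : ContDiffBump (0 : RN N)) {f : RN N → ℝ} {M : ℝ}
    (hM : ∀ x, |f x| ≤ M) (x : RN N) :
    |(convolution (ρ.normed volume) f (lsmul ℝ ℝ) volume) x| ≤ M := by
  rw [convolution_lsmul, ← Real.norm_eq_abs]
  have hint : Integrable (fun t => ρ.normed volume t * M) volume := ρ.integrable_normed.mul_const M
  refine (norm_integral_le_of_norm_le hint
    (Eventually.of_forall fun t => ?_)).trans ?_
  · rw [norm_smul, Real.norm_of_nonneg (ρ.nonneg_normed t)]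
    exact mul_le_mul_of_nonneg_left (hM _) (ρ.nonneg_normed t)
  · rw [integral_mul_const, ρ.integral_normed, one_mul]

-- The derivative is put on `b`, leaving the kernel intact so that `integral_mul_convolution` can
-- then move it to the other factor.
open ContinuousLinearMap in
theorem fderiv_convolution_apply {N : ℕ} {ρ b : RN N → ℝ} (hρ : Continuous ρ)
    (hb : ContDiff ℝ 1 b) (hbs : HasCompactSupport b) (x v : RN N) :
    fderiv ℝ (convolution ρ b (lsmul ℝ ℝ) volume) x v =
      (convolution ρ (fun y => fderiv ℝ b y v) (lsmul ℝ ℝ) volume) x := by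
  rw [(hbs.hasFDerivAt_convolution_right (lsmul ℝ ℝ) hρ.locallyIntegrable hb x).fderiv]
  exact convolution_precompR_apply (lsmul ℝ ℝ) hρ.locallyIntegrable (hbs.fderiv ℝ)
    (hb.continuous_fderiv one_ne_zero) x v

/-- A sequence of bump functions concentrating at the origin. -/
noncomputable def bumpSeq (N n : ℕ) : ContDiffBump (0 : RN N) where
  rIn := 1 / ((n : ℝ) + 1) / 2
  rOut := 1 / ((n : ℝ) + 1)
  rIn_pos := by positivity
  rIn_lt_rOut := half_lt_self (by positivity)

theorem bumpSeq_rOut_tendsto (N : ℕ) : Tendsto (fun n => (bumpSeq N n).rOut) atTop (𝓝 0) :=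
  tendsto_one_div_add_atTop_nhds_zero_nat

open ContinuousLinearMap in
/-- Chain rule for a continuous bounded function with a distributional derivative. -/
theorem integral_comp_mul_fderiv {N : ℕ} {Ω : Opens (RN N)} {f g : RN N → ℝ} {v : RN N}
    (hf : Continuous f) {M : ℝ} (hM : ∀ x, |f x| ≤ M)
    (hg : LocallyIntegrable g (volume.restrict (Ω : Set (RN N))))
    (hw : ∀ ψ : TestFunction Ω ℝ ⊤, ∫ x in (Ω : Set (RN N)), f x * fderiv ℝ ψ x v
      = - ∫ x in (Ω : Set (RN N)), g x * ψ x)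
    {h : ℝ → ℝ} (hh : ContDiff ℝ ((⊤ : ℕ∞) : WithTop ℕ∞) h) (hh1 : ∀ t, |deriv h t| ≤ 1)
    (φ : TestFunction Ω ℝ ⊤) :
    ∫ x in (Ω : Set (RN N)), h (f x) * fderiv ℝ φ x v
      = - ∫ x in (Ω : Set (RN N)), (deriv h (f x) * g x) * φ x := by
  have hφ : ContDiff ℝ ((⊤ : ℕ∞) : WithTop ℕ∞) φ := φ.contDiff'
  have hφs : HasCompactSupport φ := φ.hasCompactSupport'
  have hφΩ : tsupport φ ⊆ Ω := φ.tsupport_subset'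
  have hh' : ContDiff ℝ ((⊤ : ℕ∞) : WithTop ℕ∞) (deriv h) := (contDiff_infty_iff_deriv.mp hh).2
  have hone : ((⊤ : ℕ∞) : WithTop ℕ∞) ≠ 0 := by simp
  let ρ : ℕ → RN N → ℝ := fun n => (bumpSeq N n).normed volume
  have hρ : ∀ n, ContDiff ℝ ((⊤ : ℕ∞) : WithTop ℕ∞) (ρ n) := fun n =>
    (bumpSeq N n).contDiff_normed
  have hρs : ∀ n, HasCompactSupport (ρ n) := fun n => (bumpSeq N n).hasCompactSupport_normed
  let U : ℕ → RN N → ℝ := fun n => convolution (ρ n) f (lsmul ℝ ℝ) volume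
  have hU : ∀ n, ContDiff ℝ ((⊤ : ℕ∞) : WithTop ℕ∞) (U n) := fun n =>
    (hρs n).contDiff_convolution_left _ (hρ n) hf.locallyIntegrable
  have hUM : ∀ n x, |U n x| ≤ M := fun n x => abs_normed_convolution_le _ hM x
  -- Convergence is needed jointly in `n` and the point, because `b n`, built from `U n`, is itself
  -- mollified below.
  have hUt : ∀ x, Tendsto (Function.uncurry U) (atTop ×ˢ 𝓝 x) (𝓝 (f x)) := fun x =>
    ContDiffBump.convolution_tendsto_right (φ := fun i : ℕ × RN N => bumpSeq N i.1)
      (g := fun _ => f) (k := Prod.snd) ((bumpSeq_rOut_tendsto N).comp tendsto_fst)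
      (Eventually.of_forall fun _ => hf.aestronglyMeasurable)
      ((hf.tendsto x).comp tendsto_snd) tendsto_snd
  have hUt' : ∀ x, Tendsto (fun n => U n x) atTop (𝓝 (f x)) := fun x =>
    ContDiffBump.convolution_tendsto_right_of_continuous (bumpSeq_rOut_tendsto N) hf x
  let b : ℕ → RN N → ℝ := fun n x => deriv h (U n x) * φ x
  have hb : ∀ n, ContDiff ℝ ((⊤ : ℕ∞) : WithTop ℕ∞) (b n) := fun n =>
    (hh'.comp (hU n)).mul hφ
  have hbs : ∀ n, HasCompactSupport (b n) := fun n => hφs.mul_left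
  obtain ⟨B, hB⟩ := hφs.exists_bound_of_continuous hφ.continuous
  have hbB : ∀ n x, |b n x| ≤ B := fun n x => by
    rw [abs_mul]
    calc _ ≤ 1 * B := mul_le_mul (hh1 _) (hB x) (abs_nonneg _) zero_le_one
      _ = B := one_mul B
  have hbt : ∀ x, Tendsto (Function.uncurry b) (atTop ×ˢ 𝓝 x) (𝓝 (deriv h (f x) * φ x)) :=
    fun x => ((hh'.continuous.tendsto _).comp (hUt x)).mul
      ((hφ.continuous.tendsto x).comp tendsto_snd)
  -- The weak derivative of `f` is tested against `ψ n`. Moving the even kernel onto `f` produces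
  -- the smooth `U n`, to which classical integration by parts and the chain rule apply. Thus `g`,
  -- known only on `Ω`, is never mollified.
  let ψ : ℕ → RN N → ℝ := fun n => convolution (ρ n) (b n) (lsmul ℝ ℝ) volume
  have hψ : ∀ n, ContDiff ℝ ((⊤ : ℕ∞) : WithTop ℕ∞) (ψ n) := fun n =>
    (hρs n).contDiff_convolution_left _ (hρ n) (hb n).continuous.locallyIntegrable
  have hψs : ∀ n, HasCompactSupport (ψ n) := fun n => (hρs n).convolution _ (hbs n)
  have hψB : ∀ n x, |ψ n x| ≤ B := fun n x => abs_normed_convolution_le _ (hbB n) x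
  have hψt : ∀ x, Tendsto (fun n => ψ n x) atTop (𝓝 (deriv h (f x) * φ x)) := fun x =>
    ContDiffBump.convolution_tendsto_right (bumpSeq_rOut_tendsto N)
      (Eventually.of_forall fun n => (hb n).continuous.aestronglyMeasurable) (hbt x)
      tendsto_const_nhds
  have hψsupp : ∀ n, tsupport (ψ n) ⊆ Metric.cthickening (1 / ((n : ℝ) + 1)) (tsupport φ) := by
    intro n
    refine closure_minimal ?_ Metric.isClosed_cthickening
    refine (support_convolution_subset _).trans ?_
    rintro _ ⟨y, hy, z, hz, rfl⟩
    have hy' : y ∈ Metric.ball (0 : RN N) (1 / ((n : ℝ) + 1)) := by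
      have hy' : y ∈ Function.support ((bumpSeq N n).normed volume) := hy
      rwa [ContDiffBump.support_normed_eq] at hy'
    have hz' : z ∈ tsupport φ := subset_tsupport _ (right_ne_zero_of_mul hz)
    refine Metric.mem_cthickening_of_dist_le _ z _ _ hz' ?_
    simpa using (mem_ball_zero_iff.mp hy').le
  obtain ⟨δ, hδ, hδΩ⟩ := hφs.isCompact.exists_cthickening_subset_open Ω.isOpen hφΩ
  have hev : ∀ᶠ n : ℕ in atTop, tsupport (ψ n) ⊆ Ω := by
    filter_upwards [(tendsto_one_div_add_atTop_nhds_zero_nat (𝕜 := ℝ)).eventually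
      (gt_mem_nhds hδ)] with n hn
    exact (hψsupp n).trans ((Metric.cthickening_mono hn.le _).trans hδΩ)
  have hwhole : ∀ (a c : RN N → ℝ), tsupport c ⊆ Ω →
      ∫ x in (Ω : Set (RN N)), a x * fderiv ℝ c x v = ∫ x, a x * fderiv ℝ c x v := by
    intro a c hc
    refine setIntegral_eq_integral_of_forall_compl_eq_zero fun x hx => ?_
    rw [image_eq_zero_of_notMem_tsupport (fun hx' => hx (hc (tsupport_fderiv_subset ℝ hx')))]
    simp
  have hfd : ∀ {c : RN N → ℝ}, ContDiff ℝ ((⊤ : ℕ∞) : WithTop ℕ∞) c →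
      Continuous fun x => fderiv ℝ c x v := fun hc =>
    (hc.continuous_fderiv hone).clm_apply continuous_const
  have hfds : ∀ {c : RN N → ℝ}, HasCompactSupport c →
      HasCompactSupport fun x => fderiv ℝ c x v := fun hc => hc.fderiv_apply ℝ v
  have hparts : ∀ {a c : RN N → ℝ}, ContDiff ℝ ((⊤ : ℕ∞) : WithTop ℕ∞) a →
      ContDiff ℝ ((⊤ : ℕ∞) : WithTop ℕ∞) c → HasCompactSupport c →
      ∫ x, a x * fderiv ℝ c x v = - ∫ x, fderiv ℝ a x v * c x := fun ha hc hcs =>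
    integral_mul_fderiv_eq_neg_fderiv_mul_of_integrable
      (((hfd ha).mul hc.continuous).integrable_of_hasCompactSupport hcs.mul_left)
      ((ha.continuous.mul (hfd hc)).integrable_of_hasCompactSupport (hfds hcs).mul_left)
      ((ha.continuous.mul hc.continuous).integrable_of_hasCompactSupport hcs.mul_left)
      (fun x _ => ha.differentiable hone x) (fun x _ => hc.differentiable hone x)
  have hleft : ∀ n, ∫ x, f x * fderiv ℝ (ψ n) x v = ∫ x, h (U n x) * fderiv ℝ φ x v := by
    intro n
    calc ∫ x, f x * fderiv ℝ (ψ n) x v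
        = ∫ x, f x * (convolution (ρ n) (fun y => fderiv ℝ (b n) y v) (lsmul ℝ ℝ) volume) x := by
          simp only [ψ, fderiv_convolution_apply (hρ n).continuous
            ((hb n).of_le (by exact_mod_cast le_top)) (hbs n)]
      _ = ∫ x, U n x * fderiv ℝ (b n) x v :=
          integral_mul_convolution (hρ n).continuous (hρs n)
            (fun x => (bumpSeq N n).normed_neg x) hf (hfd (hb n)) (hfds (hbs n))
      _ = - ∫ x, fderiv ℝ (U n) x v * b n x := hparts (hU n) (hb n) (hbs n)
      _ = - ∫ x, fderiv ℝ (fun y => h (U n y)) x v * φ x := by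
          congr 1
          refine integral_congr_ae (Eventually.of_forall fun x => ?_)
          have hd : HasFDerivAt (fun y => h (U n y)) (deriv h (U n x) • fderiv ℝ (U n) x) x :=
            (hh.differentiable hone _).hasDerivAt.comp_hasFDerivAt x
              ((hU n).differentiable hone x).hasFDerivAt
          simp only [b, hd.fderiv, FunLike.coe_smul, Pi.smul_apply, smul_eq_mul]
          ring
      _ = _ := (hparts (hh.comp (hU n)) hφ hφs).symm
  have hL : Tendsto (fun n => ∫ x, h (U n x) * fderiv ℝ φ x v) atTop
      (𝓝 (∫ x, h (f x) * fderiv ℝ φ x v)) := by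
    obtain ⟨H, hH⟩ := (isCompact_Icc (a := -M) (b := M)).exists_bound_of_continuousOn
      hh.continuous.continuousOn
    refine tendsto_integral_of_dominated_convergence (fun x => H * ‖fderiv ℝ φ x v‖)
      (fun n => ((hh.continuous.comp (hU n).continuous).mul (hfd hφ)).aestronglyMeasurable)
      (((hfd hφ).integrable_of_hasCompactSupport (hfds hφs)).norm.const_mul H)
      (fun n => Eventually.of_forall fun x => ?_)
      (Eventually.of_forall fun x =>
        ((hh.continuous.tendsto _).comp (hUt' x)).mul tendsto_const_nhds)
    rw [norm_mul]
    exact mul_le_mul_of_nonneg_right (hH _ (abs_le.mp (hUM n x))) (norm_nonneg _)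
  have hR : Tendsto (fun n => ∫ x in (Ω : Set (RN N)), g x * ψ n x) atTop
      (𝓝 (∫ x in (Ω : Set (RN N)), g x * (deriv h (f x) * φ x))) := by
    have hK : IsCompact (Metric.cthickening 1 (tsupport φ)) := hφs.isCompact.cthickening
    refine tendsto_integral_of_dominated_convergence
      ((Metric.cthickening 1 (tsupport φ)).indicator fun x => ‖g x‖ * B)
      (fun n => hg.aestronglyMeasurable.mul (hψ n).continuous.aestronglyMeasurable)
      ?_ (fun n => Eventually.of_forall fun x => ?_)
      (Eventually.of_forall fun x => tendsto_const_nhds.mul (hψt x))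
    · rw [integrable_indicator_iff hK.measurableSet]
      exact (hg.integrableOn_isCompact hK).norm.mul_const B
    · by_cases hx : x ∈ Metric.cthickening 1 (tsupport φ)
      · rw [Set.indicator_of_mem hx, norm_mul]
        exact mul_le_mul_of_nonneg_left (hψB n x) (norm_nonneg _)
      · rw [Set.indicator_of_notMem hx, image_eq_zero_of_notMem_tsupport (f := ψ n)]
        · simp
        · refine fun h => hx (Metric.cthickening_mono ?_ _ (hψsupp n h))
          rw [div_le_one (by positivity)]
          linarith [(Nat.cast_nonneg n : (0 : ℝ) ≤ n)]
  have heq : ∀ᶠ n in atTop, ∫ x, h (U n x) * fderiv ℝ φ x v =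
      - ∫ x in (Ω : Set (RN N)), g x * ψ n x := by
    filter_upwards [hev] with n hn
    rw [← hleft, ← hwhole _ _ hn]
    exact hw ⟨ψ n, hψ n, hψs n, hn⟩
  rw [hwhole _ _ hφΩ, tendsto_nhds_unique (hL.congr' heq) hR.neg]
  congr 1
  exact integral_congr_ae (Eventually.of_forall fun x => by simp only; ring)

/-! ### Limits of bounded sequences in uniformly convex spaces -/

/-- Bounded weak limits: in a uniformly convex Banach space, if `w n` is bounded and its image
under `π` converges, then the limit has a preimage in any closed convex set containing the `w n`. -/
theorem UniformlyConvexPow.exists_mem_of_tendsto {p : ℝ} (hp : 1 < p) {E F : Type*}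
    [NormedAddCommGroup E] [NormedSpace ℝ E] [CompleteSpace E] [NormedAddCommGroup F]
    [NormedSpace ℝ F] (hE : UniformlyConvexPow p E) (π : E →L[ℝ] F) {S : Set E}
    (hS : IsClosed S) (hSc : Convex ℝ S) {w : ℕ → E} (hw : ∀ n, w n ∈ S) {R : ℕ → ℝ} {r : ℝ}
    (hR : Tendsto R atTop (𝓝 r)) (hwR : ∀ n, ‖w n‖ ≤ R n) {a : F}
    (ha : Tendsto (fun n => π (w n)) atTop (𝓝 a)) :
    ∃ y ∈ S, π y = a ∧ ‖y‖ ≤ r := by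
  have hr : 0 ≤ r := ge_of_tendsto' hR fun n => (norm_nonneg _).trans (hwR n)
  -- As in Mazur's lemma, the selection is made from the convex hulls of the tails; `π` sends these
  -- into small balls around `a`, which identifies `π y`.
  obtain ⟨z, y, hz, hzy, hyr⟩ := hE.exists_tendsto hp
    (K := fun n => convexHull ℝ (w '' Set.Ici n))
    (fun m n hmn => convexHull_mono (Set.image_mono (Set.Ici_subset_Ici.mpr hmn)))
    (fun n => convex_convexHull ℝ _) hr (fun n ε hε => by
      obtain ⟨k, hk, hkn⟩ := ((hR.eventually (ge_mem_nhds (show r < r + ε by linarith))).and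
        (eventually_ge_atTop n)).exists
      exact ⟨w k, subset_convexHull ℝ _ ⟨k, hkn, rfl⟩, (hwR k).trans hk⟩)
  have hzS : ∀ n, z n ∈ S := fun n =>
    convexHull_min (by rintro _ ⟨k, -, rfl⟩; exact hw k) hSc (hz n)
  refine ⟨y, hS.mem_of_tendsto hzy (Eventually.of_forall hzS), ?_, hyr⟩
  refine tendsto_nhds_unique ((π.continuous.tendsto y).comp hzy) ?_
  rw [Metric.tendsto_atTop]
  intro ε hε
  obtain ⟨n, hn⟩ := Metric.tendsto_atTop.mp ha ε hε
  refine ⟨n, fun k hk => ?_⟩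
  have hsub : convexHull ℝ (w '' Set.Ici k) ⊆ π ⁻¹' Metric.ball a ε := by
    refine convexHull_min ?_ ((convex_ball a ε).linear_preimage π.toLinearMap)
    rintro _ ⟨j, hj, rfl⟩
    exact hn j (hk.trans hj)
  exact hsub (hz k)

/-! ### The Sobolev space as a closed graph -/

/-- Tuples of `L^p` functions `(u, g₁, …, g_N)` with the `ℓ^p` norm. -/
abbrev LpTuple {N : ℕ} (p : ℝ) (Ω : Opens (RN N)) : Type :=
  PiLp (ENNReal.ofReal p) fun _ : Option (Fin N) => LpOn p Ω

theorem exists_integral_mul_clm {N : ℕ} {p : ℝ} [Fact (1 ≤ ENNReal.ofReal p)] (Ω : Opens (RN N))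
    {c : RN N → ℝ} (hc : Continuous c) (hcs : HasCompactSupport c) :
    ∃ L : LpOn p Ω →L[ℝ] ℝ, ∀ u, L u = ∫ x in (Ω : Set (RN N)), u x * c x := by
  have hm : MemLp c (ENNReal.ofReal p).conjExponent (volume.restrict (Ω : Set (RN N))) :=
    hc.memLp_of_hasCompactSupport hcs
  have : Fact (1 ≤ (ENNReal.ofReal p).conjExponent) :=
    ⟨ENNReal.HolderConjugate.one_le _ (ENNReal.ofReal p)⟩
  refine ⟨((ContinuousLinearMap.mul ℝ ℝ).lpPairing _ (ENNReal.ofReal p)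
    (ENNReal.ofReal p).conjExponent).flip (hm.toLp c), fun u => ?_⟩
  rw [ContinuousLinearMap.flip_apply, ContinuousLinearMap.lpPairing_eq_integral]
  refine integral_congr_ae ?_
  filter_upwards [hm.coeFn_toLp] with x hx
  rw [hx]; rfl

/-- By Hölder, testing against one `φ` is a continuous linear condition on the tuple, so the graph
is an intersection of closed kernels. -/
theorem exists_weakPartial_clm {N : ℕ} {p : ℝ} [Fact (1 ≤ ENNReal.ofReal p)] {Ω : Opens (RN N)}
    (i : Fin N) (φ : TestFunction Ω ℝ ⊤) :
    ∃ L : LpTuple p Ω →L[ℝ] ℝ, ∀ x, L x = 0 ↔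
      ∫ t in (Ω : Set (RN N)), x none t * fderiv ℝ φ t (EuclideanSpace.single i 1)
        = - ∫ t in (Ω : Set (RN N)), x (some i) t * φ t := by
  have hφ : ContDiff ℝ ((⊤ : ℕ∞) : WithTop ℕ∞) φ := φ.contDiff'
  have hφs : HasCompactSupport φ := φ.hasCompactSupport'
  obtain ⟨L₁, h₁⟩ := exists_integral_mul_clm (p := p) Ω
    (c := fun t => fderiv ℝ φ t (EuclideanSpace.single i 1))
    ((hφ.continuous_fderiv (by simp)).clm_apply continuous_const)
    (hφs.fderiv_apply ℝ _)
  obtain ⟨L₂, h₂⟩ := exists_integral_mul_clm (p := p) Ω hφ.continuous hφs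
  refine ⟨L₁ ∘L PiLp.proj _ _ none + L₂ ∘L PiLp.proj _ _ (some i), fun x => ?_⟩
  simp only [_root_.add_apply, ContinuousLinearMap.comp_apply, PiLp.proj_apply, h₁, h₂]
  exact add_eq_zero_iff_eq_neg

/-- The tuples `(u, ∂₁u, …, ∂_Nu)` with `u ∈ W^{1,p}(Ω)`. -/
noncomputable def sobolevGraph {N : ℕ} (p : ℝ) [Fact (1 ≤ ENNReal.ofReal p)] (Ω : Opens (RN N)) :
    Submodule ℝ (LpTuple p Ω) :=
  ⨅ (i : Fin N) (φ : TestFunction Ω ℝ ⊤),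
    ((exists_weakPartial_clm (p := p) i φ).choose : LpTuple p Ω →ₗ[ℝ] ℝ).ker

theorem weakPartial_eq {N : ℕ} {p : ℝ} {Ω : Opens (RN N)} (hp : 1 ≤ p) {i : Fin N}
    {u g : LpOn p Ω} (h : HasWeakPartial i u g) : weakPartial i u = g := by
  have hex : ∃ g : LpOn p Ω, HasWeakPartial i u g := ⟨g, h⟩
  rw [weakPartial, dif_pos hex]
  exact hex.choose_spec.unique hp h

section Graph

variable {N : ℕ} {p : ℝ} [Fact (1 ≤ ENNReal.ofReal p)] {Ω : Opens (RN N)}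

theorem mem_sobolevGraph {x : LpTuple p Ω} :
    x ∈ sobolevGraph p Ω ↔ ∀ i, HasWeakPartial i (x none) (x (some i)) := by
  simp only [sobolevGraph, Submodule.mem_iInf, LinearMap.mem_ker, ContinuousLinearMap.coe_coe,
    (exists_weakPartial_clm (p := p) _ _).choose_spec, HasWeakPartial]

theorem isClosed_sobolevGraph : IsClosed (sobolevGraph p Ω : Set (LpTuple p Ω)) := by
  simp only [sobolevGraph, Submodule.coe_iInf]
  exact isClosed_iInter fun i => isClosed_iInter fun φ =>
    (exists_weakPartial_clm (p := p) i φ).choose.isClosed_ker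

theorem norm_rpow_eq_sum (hp : 0 < p) (x : LpTuple p Ω) : ‖x‖ ^ p = ∑ j, ‖x j‖ ^ p := by
  rw [PiLp.norm_eq_sum (by simpa [ENNReal.toReal_ofReal hp.le] using hp)]
  simp only [ENNReal.toReal_ofReal hp.le]
  rw [← Real.rpow_mul (Finset.sum_nonneg fun _ _ => by positivity), one_div_mul_cancel hp.ne',
    Real.rpow_one]

theorem norm_le_norm_of_forall (hp : 0 < p) {x y : LpTuple p Ω} (h : ∀ j, ‖y j‖ ≤ ‖x j‖) :
    ‖y‖ ≤ ‖x‖ := by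
  rw [← Real.rpow_le_rpow_iff (norm_nonneg _) (norm_nonneg _) hp, norm_rpow_eq_sum hp,
    norm_rpow_eq_sum hp]
  exact Finset.sum_le_sum fun j _ => Real.rpow_le_rpow (norm_nonneg _) (h j) hp.le

/-- Uniqueness of weak derivatives makes the choice in `weakPartial` agree with the components of
the tuple. -/
theorem sobolevNormPow_eq (hp : 1 ≤ p) {x : LpTuple p Ω} (hx : x ∈ sobolevGraph p Ω) :
    sobolevNormPow (x none) = ‖x‖ ^ p := by
  rw [norm_rpow_eq_sum (by linarith), Fintype.sum_option, sobolevNormPow]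
  congr 1
  exact Finset.sum_congr rfl fun i _ => by rw [weakPartial_eq hp (mem_sobolevGraph.mp hx i)]

theorem sobolevNorm_eq (hp : 1 ≤ p) {x : LpTuple p Ω} (hx : x ∈ sobolevGraph p Ω) :
    sobolevNorm (x none) = ‖x‖ := by
  rw [sobolevNorm, sobolevNormPow_eq hp hx, ← Real.rpow_mul (norm_nonneg _),
    mul_one_div_cancel (by linarith), Real.rpow_one]

theorem exists_mem_sobolevGraph {u : LpOn p Ω} (hu : u ∈ W1p p Ω) :
    ∃ x ∈ sobolevGraph p Ω, x none = u := by
  choose g hg using hu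
  exact ⟨WithLp.toLp _ fun j => j.elim u g, mem_sobolevGraph.mpr hg, rfl⟩

theorem none_mem_W1p {x : LpTuple p Ω} (hx : x ∈ sobolevGraph p Ω) : x none ∈ W1p p Ω :=
  fun i => ⟨_, mem_sobolevGraph.mp hx i⟩

end Graph

/-- The part of the graph over `W^{1,p}(Ω) ∩ C_c(closure Ω)`. -/
noncomputable def sobolevGraphCc {N : ℕ} (p : ℝ) [Fact (1 ≤ ENNReal.ofReal p)]
    (Ω : Opens (RN N)) : Submodule ℝ (LpTuple p Ω) where
  carrier := {x | x ∈ sobolevGraph p Ω ∧ x none ∈ W1pCc p Ω}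
  add_mem' := by
    rintro x y ⟨hx, -, f, hf⟩ ⟨hy, -, g, hg⟩
    have hxy := add_mem hx hy
    refine ⟨hxy, none_mem_W1p hxy, f + g, ?_⟩
    filter_upwards [hf, hg, Lp.coeFn_add (x none) (y none)] with t h1 h2 h3 ht
    rw [PiLp.add_apply, h3, Pi.add_apply, h1 ht, h2 ht]; rfl
  zero_mem' := by
    refine ⟨zero_mem _, none_mem_W1p (zero_mem _), 0, ?_⟩
    filter_upwards [Lp.coeFn_zero ℝ (ENNReal.ofReal p) (volume.restrict (Ω : Set (RN N)))]
      with t h1 ht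
    rw [PiLp.zero_apply, h1]; rfl
  smul_mem' := by
    rintro c x ⟨hx, -, f, hf⟩
    have hcx := Submodule.smul_mem _ c hx
    refine ⟨hcx, none_mem_W1p hcx, c • f, ?_⟩
    filter_upwards [hf, Lp.coeFn_smul c (x none)] with t h1 h2 ht
    rw [PiLp.smul_apply, h2, Pi.smul_apply, h1 ht]; rfl

/-- The graph of the gradient over `W1pTilde`. -/
noncomputable def sobolevGraphTilde {N : ℕ} (p : ℝ) [Fact (1 ≤ ENNReal.ofReal p)]
    (Ω : Opens (RN N)) : Submodule ℝ (LpTuple p Ω) :=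
  (sobolevGraphCc p Ω).topologicalClosure

section Tilde

variable {N : ℕ} {p : ℝ} [Fact (1 ≤ ENNReal.ofReal p)] {Ω : Opens (RN N)}

theorem sobolevGraphTilde_le : sobolevGraphTilde p Ω ≤ sobolevGraph p Ω :=
  Submodule.topologicalClosure_minimal _ (fun _ hx => hx.1) isClosed_sobolevGraph

theorem isClosed_sobolevGraphTilde : IsClosed (sobolevGraphTilde p Ω : Set (LpTuple p Ω)) :=
  Submodule.isClosed_topologicalClosure _

/-- Forgetting the derivatives is an isometry from the graph onto `W1p` with its Sobolev norm, so
approximation in that norm is topological closure among tuples. -/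
theorem mem_W1pTilde_iff (hp : 1 ≤ p) {u : LpOn p Ω} :
    u ∈ W1pTilde p Ω ↔ ∃ x ∈ sobolevGraphTilde p Ω, x none = u := by
  constructor
  · rintro ⟨hu, h⟩
    obtain ⟨x, hx, rfl⟩ := exists_mem_sobolevGraph hu
    refine ⟨x, ?_, rfl⟩
    refine Metric.mem_closure_iff.mpr fun ε hε => ?_
    obtain ⟨v, hv, hlt⟩ := h ε hε
    obtain ⟨y, hy, rfl⟩ := exists_mem_sobolevGraph hv.1
    refine ⟨y, ⟨hy, hv⟩, ?_⟩
    rwa [dist_eq_norm, ← sobolevNorm_eq hp (sub_mem hx hy)]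
  · rintro ⟨x, hx, rfl⟩
    have hxG := sobolevGraphTilde_le hx
    refine ⟨none_mem_W1p hxG, fun ε hε => ?_⟩
    obtain ⟨y, ⟨hy, hyc⟩, hlt⟩ := Metric.mem_closure_iff.mp hx ε hε
    refine ⟨y none, hyc, ?_⟩
    rwa [dist_eq_norm, ← sobolevNorm_eq hp (sub_mem hxG hy)] at hlt

end Tilde

/-! ### Stability under absolute values -/

/-- A smooth approximation of the absolute value. -/
noncomputable def smoothAbs (δ t : ℝ) : ℝ := √(t ^ 2 + δ ^ 2) - δ

section SmoothAbs

variable {δ : ℝ}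

theorem contDiff_smoothAbs (hδ : 0 < δ) : ContDiff ℝ ((⊤ : ℕ∞) : WithTop ℕ∞) (smoothAbs δ) :=
  (((contDiff_id.pow 2).add contDiff_const).sqrt fun t => by
    have : 0 < t ^ 2 + δ ^ 2 := by positivity
    exact this.ne').sub contDiff_const

theorem abs_deriv_smoothAbs_le (hδ : 0 < δ) (t : ℝ) : |deriv (smoothAbs δ) t| ≤ 1 := by
  have hpos : 0 < t ^ 2 + δ ^ 2 := by positivity
  have hd : HasDerivAt (smoothAbs δ) (2 * t / (2 * √(t ^ 2 + δ ^ 2))) t := by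
    have h : HasDerivAt (fun s : ℝ => √(s ^ 2 + δ ^ 2)) (2 * t / (2 * √(t ^ 2 + δ ^ 2))) t := by
      simpa using (((hasDerivAt_id t).pow 2).add_const (δ ^ 2)).sqrt hpos.ne'
    exact h.sub_const δ
  rw [hd.deriv, mul_div_mul_left _ _ two_ne_zero, abs_div, abs_of_nonneg (Real.sqrt_nonneg _),
    div_le_one (Real.sqrt_pos.mpr hpos)]
  exact Real.abs_le_sqrt (by nlinarith)

theorem smoothAbs_nonneg (δ t : ℝ) : 0 ≤ smoothAbs δ t :=
  sub_nonneg.mpr (Real.le_sqrt_of_sq_le (by nlinarith [sq_nonneg t]))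

theorem smoothAbs_le (hδ : 0 < δ) (t : ℝ) : smoothAbs δ t ≤ |t| := by
  rw [smoothAbs, sub_le_iff_le_add]
  refine Real.sqrt_le_iff.mpr ⟨by positivity, ?_⟩
  nlinarith [sq_abs t, mul_nonneg (abs_nonneg t) hδ.le]

theorem abs_smoothAbs_le (hδ : 0 < δ) (t : ℝ) : |smoothAbs δ t| ≤ |t| := by
  rw [abs_of_nonneg (smoothAbs_nonneg δ t)]; exact smoothAbs_le hδ t

theorem smoothAbs_tendsto {δ : ℕ → ℝ} (hδ : Tendsto δ atTop (𝓝 0)) (t : ℝ) :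
    Tendsto (fun n => smoothAbs (δ n) t) atTop (𝓝 |t|) := by
  have hc : Continuous fun d : ℝ => smoothAbs d t := by unfold smoothAbs; fun_prop
  have := (hc.tendsto 0).comp hδ
  simpa [smoothAbs, Real.sqrt_sq_eq_abs, Function.comp_def] using this

end SmoothAbs

section Abs

variable {N : ℕ} {p : ℝ} [Fact (1 ≤ ENNReal.ofReal p)] {Ω : Opens (RN N)}

/-- `smoothAbs δ` vanishes at 0, which preserves compact support, and is dominated by `|·|` with
derivative at most 1 in modulus, so no component of the tuple grows in norm. -/
theorem exists_smoothAbs_mem (hp : 1 < p) {x : LpTuple p Ω} (hx : x ∈ sobolevGraphCc p Ω) {δ : ℝ}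
    (hδ : 0 < δ) : ∃ y ∈ sobolevGraphCc p Ω, ‖y‖ ≤ ‖x‖ ∧
      ∀ᵐ t ∂(volume.restrict (Ω : Set (RN N))), y none t = smoothAbs δ (x none t) := by
  obtain ⟨hxG, -, f, hf⟩ := hx
  have hh := contDiff_smoothAbs hδ
  have hh0 : smoothAbs δ 0 = 0 := by simp [smoothAbs, Real.sqrt_sq hδ.le]
  obtain ⟨B, hB⟩ := f.hasCompactSupport.exists_bound_of_continuous f.continuous
  let fb : BoundedContinuousFunction (closure (Ω : Set (RN N))) ℝ :=
    BoundedContinuousFunction.ofNormedAddCommGroup f f.continuous B hB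
  -- The chain rule requires a bounded continuous function on all of `ℝ^N`; Tietze extension from
  -- the closure of `Ω` provides one.
  obtain ⟨F, -, hF⟩ :=
    BoundedContinuousFunction.exists_norm_eq_domRestrict_eq_of_closed fb isClosed_closure
  have hFf : ∀ᵐ t ∂(volume.restrict (Ω : Set (RN N))), x none t = F t := by
    filter_upwards [hf, ae_restrict_mem Ω.isOpen.measurableSet] with t ht htΩ
    rw [ht (subset_closure htΩ)]
    exact (DFunLike.congr_fun hF ⟨t, subset_closure htΩ⟩).symm
  have hmem : ∀ (v : RN N → ℝ) (u : LpOn p Ω),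
      AEStronglyMeasurable v (volume.restrict (Ω : Set (RN N))) → (∀ t, |v t| ≤ |u t|) →
      MemLp v (ENNReal.ofReal p) (volume.restrict (Ω : Set (RN N))) := fun v u hv h =>
    (Lp.memLp u).mono hv (Eventually.of_forall h)
  have hm0 := hmem (fun t => smoothAbs δ (x none t)) (x none)
    (hh.continuous.comp_aestronglyMeasurable (Lp.aestronglyMeasurable _))
    fun t => abs_smoothAbs_le hδ _
  have hmi := fun i : Fin N => hmem (fun t => deriv (smoothAbs δ) (F t) * x (some i) t) (x (some i))
    (((hh.continuous_deriv (by simp)).comp F.continuous).aestronglyMeasurable.mul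
      (Lp.aestronglyMeasurable _))
    fun t => by
      rw [abs_mul]
      exact mul_le_of_le_one_left (abs_nonneg _) (abs_deriv_smoothAbs_le hδ _)
  let y : LpTuple p Ω := WithLp.toLp _ fun j =>
    j.elim (hm0.toLp _) fun i => (hmi i).toLp _
  have hy0 : y none =ᵐ[volume.restrict (Ω : Set (RN N))] fun t => smoothAbs δ (x none t) :=
    hm0.coeFn_toLp
  have hyi : ∀ i, y (some i) =ᵐ[volume.restrict (Ω : Set (RN N))]
      fun t => deriv (smoothAbs δ) (F t) * x (some i) t := fun i => (hmi i).coeFn_toLp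
  have hyG : y ∈ sobolevGraph p Ω := by
    refine mem_sobolevGraph.mpr fun i φ => ?_
    have hchain := integral_comp_mul_fderiv F.continuous (fun t => F.norm_coe_le_norm t)
      ((Lp.memLp (x (some i))).locallyIntegrable Fact.out)
      (v := EuclideanSpace.single i 1) (fun ψ => by
        rw [← mem_sobolevGraph.mp hxG i ψ]
        refine integral_congr_ae ?_
        filter_upwards [hFf] with t ht
        rw [ht]) hh (abs_deriv_smoothAbs_le hδ) φ
    refine Eq.trans (integral_congr_ae ?_) (hchain.trans (congrArg Neg.neg (integral_congr_ae ?_)))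
    · filter_upwards [hy0, hFf] with t h1 h2
      rw [h1, h2]
    · filter_upwards [hyi i] with t h1
      rw [h1]
  refine ⟨y, ⟨hyG, none_mem_W1p hyG, ⟨⟨fun t => smoothAbs δ (f t),
    hh.continuous.comp f.continuous⟩, f.hasCompactSupport.comp_left hh0⟩, ?_⟩, ?_, hy0⟩
  · filter_upwards [hy0, hf] with t h1 h2 ht
    rw [h1, h2 ht]; rfl
  · refine norm_le_norm_of_forall (by linarith) fun j => ?_
    refine Lp.norm_le_norm_of_ae_le ?_
    cases j with
    | none =>
      filter_upwards [hy0] with t h1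
      rw [h1]; exact abs_smoothAbs_le hδ _
    | some i =>
      filter_upwards [hyi i] with t h1
      rw [h1, norm_mul]
      exact mul_le_of_le_one_left (norm_nonneg _) (abs_deriv_smoothAbs_le hδ _)

/-- As `δ → 0` the functions converge in `L^p` by dominated convergence, while the full tuples are
only known to be bounded; `exists_mem_of_tendsto` turns this into a limit tuple with the norm bound.
-/
theorem exists_abs_mem_of_mem_sobolevGraphCc (hp : 1 < p) {x : LpTuple p Ω}
    (hx : x ∈ sobolevGraphCc p Ω) :
    ∃ y ∈ sobolevGraphTilde p Ω, y none = |x none| ∧ ‖y‖ ≤ ‖x‖ := by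
  have hp0 : 0 < p := by linarith
  have hδ : ∀ n : ℕ, 0 < 1 / ((n : ℝ) + 1) := fun n => by positivity
  choose y hyc hyn hy using fun n : ℕ => exists_smoothAbs_mem hp hx (hδ n)
  refine (uniformlyConvexPow_piLp _ hp).exists_mem_of_tendsto hp
    (PiLp.proj _ (fun _ : Option (Fin N) => LpOn p Ω) none : LpTuple p Ω →L[ℝ] LpOn p Ω)
    isClosed_sobolevGraphTilde (sobolevGraphTilde p Ω).convex
    (fun n => Submodule.le_topologicalClosure _ (hyc n)) (tendsto_const_nhds (x := ‖x‖)) hyn ?_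
  have hint : Tendsto (fun n => ‖y n none - |x none|‖ ^ p) atTop (𝓝 0) := by
    simp only [Lp_norm_rpow_eq_integral hp0]
    have hcont : Continuous fun t : ℝ => |t| ^ p :=
      (Real.continuous_rpow_const hp0.le).comp continuous_abs
    have hpt : ∀ᵐ t ∂(volume.restrict (Ω : Set (RN N))), ∀ n, (y n none - |x none|) t =
        smoothAbs (1 / ((n : ℝ) + 1)) (x none t) - |x none t| := by
      rw [ae_all_iff]
      intro n
      filter_upwards [hy n, Lp.coeFn_sub (y n none) |x none|, Lp.coeFn_abs (x none)]
        with t h1 h2 h3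
      rw [h2, Pi.sub_apply, h1, h3]
    have hz : (0 : ℝ) = ∫ _ in (Ω : Set (RN N)), (0 : ℝ) := by simp
    rw [hz]
    refine tendsto_integral_of_dominated_convergence (fun t => |x none t| ^ p)
      (fun n => hcont.comp_aestronglyMeasurable (Lp.aestronglyMeasurable _))
      (integrable_abs_rpow hp0 _) (fun n => ?_) ?_
    · filter_upwards [hpt] with t ht
      rw [ht n, Real.norm_of_nonneg (by positivity)]
      refine Real.rpow_le_rpow (abs_nonneg _) ?_ hp0.le
      have := smoothAbs_nonneg (1 / ((n : ℝ) + 1)) (x none t)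
      have := smoothAbs_le (hδ n) (x none t)
      rw [abs_le]
      constructor <;> linarith
    · filter_upwards [hpt] with t ht
      simp only [ht]
      have h1 := (smoothAbs_tendsto tendsto_one_div_add_atTop_nhds_zero_nat
        (x none t)).sub_const |x none t|
      have h2 := (hcont.tendsto _).comp h1
      simpa [Real.zero_rpow hp0.ne', Function.comp_def] using h2
  rw [tendsto_iff_norm_sub_tendsto_zero]
  have h := ((Real.continuous_rpow_const (q := 1 / p) (by positivity)).tendsto 0).comp hint
  rw [Real.zero_rpow (by positivity)] at h
  refine h.congr fun n => ?_
  rw [Function.comp_apply, ← Real.rpow_mul (norm_nonneg _), mul_one_div_cancel hp0.ne',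
    Real.rpow_one]
  rfl

/-- `W1pTilde` is stable under the absolute value, which does not increase the norm. -/
theorem exists_abs_mem (hp : 1 < p) {x : LpTuple p Ω} (hx : x ∈ sobolevGraphTilde p Ω) :
    ∃ y ∈ sobolevGraphTilde p Ω, y none = |x none| ∧ ‖y‖ ≤ ‖x‖ := by
  obtain ⟨s, hs, hsx⟩ := mem_closure_iff_seq_limit.mp
    (show x ∈ closure (sobolevGraphCc p Ω : Set (LpTuple p Ω)) from hx)
  choose y hyT hya hyn using fun n => exists_abs_mem_of_mem_sobolevGraphCc hp (hs n)
  let π : LpTuple p Ω →L[ℝ] LpOn p Ω := PiLp.proj _ (fun _ : Option (Fin N) => LpOn p Ω) none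
  -- Continuity of the absolute value in the Sobolev norm is avoided: its continuity in `L^p` and
  -- the norm bound suffice.
  refine (uniformlyConvexPow_piLp _ hp).exists_mem_of_tendsto hp π isClosed_sobolevGraphTilde
    (sobolevGraphTilde p Ω).convex hyT hsx.norm hyn ?_
  have h : Tendsto (fun n => |s n none|) atTop (𝓝 |x none|) := by
    have h1 := (π.continuous.tendsto x).comp hsx
    rw [tendsto_iff_norm_sub_tendsto_zero] at h1 ⊢
    exact squeeze_zero (fun _ => norm_nonneg _) (fun n => norm_abs_sub_abs _ _) h1
  exact h.congr fun n => (hya n).symm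

end Abs

/-! ### Properties of the capacity -/

/-- The graph version of the set of admissible functions. -/
def admissibleGraph {N : ℕ} (p : ℝ) [Fact (1 ≤ ENNReal.ofReal p)] (Ω : Opens (RN N))
    (A : Set (closure (Ω : Set (RN N)))) : Set (LpTuple p Ω) :=
  {x | x ∈ sobolevGraphTilde p Ω ∧ ∃ O : Set (closure (Ω : Set (RN N))), IsOpen O ∧ A ⊆ O ∧
    ∀ᵐ t ∂(volume.restrict (Ω : Set (RN N))), t ∈ Subtype.val '' O → 1 ≤ x none t}

section Capacity

variable {N : ℕ} {p : ℝ} [Fact (1 ≤ ENNReal.ofReal p)] {Ω : Opens (RN N)}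

theorem admissibleGraph_anti {A B : Set (closure (Ω : Set (RN N)))} (h : A ⊆ B) :
    admissibleGraph p Ω B ⊆ admissibleGraph p Ω A :=
  fun _ ⟨hx, O, hO, hBO, hO1⟩ => ⟨hx, O, hO, h.trans hBO, hO1⟩

theorem convex_admissibleGraph (A : Set (closure (Ω : Set (RN N)))) :
    Convex ℝ (admissibleGraph p Ω A) := by
  rintro x ⟨hx, O, hO, hAO, hO1⟩ y ⟨hy, U, hU, hAU, hU1⟩ a b ha hb hab
  refine ⟨(sobolevGraphTilde p Ω).convex hx hy ha hb hab, O ∩ U, hO.inter hU,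
    Set.subset_inter hAO hAU, ?_⟩
  filter_upwards [hO1, hU1, Lp.coeFn_add (a • x none) (b • y none), Lp.coeFn_smul a (x none),
    Lp.coeFn_smul b (y none)] with t h1 h2 h3 h4 h5
  rintro ⟨s, ⟨hsO, hsU⟩, rfl⟩
  have e1 := h1 ⟨s, hsO, rfl⟩
  have e2 := h2 ⟨s, hsU, rfl⟩
  rw [PiLp.add_apply, PiLp.smul_apply, PiLp.smul_apply, h3, Pi.add_apply, h4, h5, Pi.smul_apply,
    Pi.smul_apply, smul_eq_mul, smul_eq_mul]
  nlinarith

theorem relCap_eq_sInf (hp : 1 ≤ p) (A : Set (closure (Ω : Set (RN N)))) :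
    relCap p Ω A =
      sInf ((fun x : LpTuple p Ω => ((‖x‖ ^ p : ℝ) : EReal)) '' admissibleGraph p Ω A) := by
  rw [relCap]
  congr 1
  ext c
  constructor
  · rintro ⟨u, ⟨hu, hO⟩, rfl⟩
    obtain ⟨x, hx, rfl⟩ := (mem_W1pTilde_iff hp).mp hu
    exact ⟨x, ⟨hx, hO⟩, by simp only [sobolevNormPow_eq hp (sobolevGraphTilde_le hx)]⟩
  · rintro ⟨x, ⟨hx, hO⟩, rfl⟩
    exact ⟨x none, ⟨(mem_W1pTilde_iff hp).mpr ⟨x, hx, rfl⟩, hO⟩,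
      by simp only [sobolevNormPow_eq hp (sobolevGraphTilde_le hx)]⟩

theorem relCap_le (hp : 1 ≤ p) {A : Set (closure (Ω : Set (RN N)))} {x : LpTuple p Ω}
    (hx : x ∈ admissibleGraph p Ω A) : relCap p Ω A ≤ ((‖x‖ ^ p : ℝ) : EReal) := by
  rw [relCap_eq_sInf hp]
  exact sInf_le ⟨x, hx, rfl⟩

theorem exists_of_relCap_lt (hp : 1 ≤ p) {A : Set (closure (Ω : Set (RN N)))} {c : EReal}
    (h : relCap p Ω A < c) : ∃ x ∈ admissibleGraph p Ω A, ((‖x‖ ^ p : ℝ) : EReal) < c := by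
  rw [relCap_eq_sInf hp] at h
  obtain ⟨_, ⟨x, hx, rfl⟩, hlt⟩ := sInf_lt_iff.mp h
  exact ⟨x, hx, hlt⟩

theorem relCap_nonneg (hp : 1 ≤ p) (A : Set (closure (Ω : Set (RN N)))) : 0 ≤ relCap p Ω A := by
  rw [relCap_eq_sInf hp]
  refine le_sInf ?_
  rintro _ ⟨x, -, rfl⟩
  exact EReal.coe_nonneg.mpr (by positivity)

theorem relCap_mono (hp : 1 ≤ p) {A B : Set (closure (Ω : Set (RN N)))} (h : A ⊆ B) :
    relCap p Ω A ≤ relCap p Ω B := by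
  rw [relCap_eq_sInf hp, relCap_eq_sInf hp]
  exact sInf_le_sInf (Set.image_mono (admissibleGraph_anti h))

theorem relCap_empty (hp : 1 ≤ p) : relCap p Ω ∅ = 0 := by
  refine le_antisymm ?_ (relCap_nonneg hp ∅)
  have h : (0 : LpTuple p Ω) ∈ admissibleGraph p Ω ∅ :=
    ⟨zero_mem _, ∅, isOpen_empty, subset_rfl, by simp⟩
  simpa [Real.zero_rpow (show p ≠ 0 by linarith)] using relCap_le hp h

/-- The open set witnessing admissibility for `A` has the same function as a competitor, hence no
larger a capacity bound. -/
theorem relCap_eq_sInf_open (hp : 1 ≤ p) (A : Set (closure (Ω : Set (RN N)))) :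
    relCap p Ω A = sInf (relCap p Ω '' {O | IsOpen O ∧ A ⊆ O}) := by
  refine le_antisymm (le_sInf ?_) ?_
  · rintro _ ⟨O, ⟨-, hAO⟩, rfl⟩
    exact relCap_mono hp hAO
  · refine le_of_forall_gt fun c hc => ?_
    obtain ⟨x, ⟨hx, O, hO, hAO, hO1⟩, hlt⟩ := exists_of_relCap_lt hp hc
    have hmem : relCap p Ω O ∈ relCap p Ω '' {O | IsOpen O ∧ A ⊆ O} := ⟨O, ⟨hO, hAO⟩, rfl⟩
    exact (sInf_le hmem).trans_lt ((relCap_le hp ⟨hx, O, hO, subset_rfl, hO1⟩).trans_lt hlt)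

theorem relCap_tendsto_iInter (hp : 1 ≤ p) {K : ℕ → Set (closure (Ω : Set (RN N)))}
    (hK : Antitone K) (hKc : ∀ n, IsCompact (K n)) :
    Tendsto (fun n => relCap p Ω (K n)) atTop (𝓝 (relCap p Ω (⋂ n, K n))) := by
  refine tendsto_order.mpr ⟨fun c hc => Eventually.of_forall fun n =>
    hc.trans_le (relCap_mono hp (Set.iInter_subset K n)), fun c hc => ?_⟩
  obtain ⟨x, ⟨hx, O, hO, hKO, hO1⟩, hlt⟩ := exists_of_relCap_lt hp hc
  obtain ⟨n, hn⟩ := exists_subset_nhds_of_isCompact hK.directed_ge hKc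
    fun t ht => hO.mem_nhds (hKO ht)
  filter_upwards [eventually_ge_atTop n] with m hm
  exact (relCap_le hp ⟨hx, O, hO, (hK hm).trans hn, hO1⟩).trans_lt hlt

/-- A convergent sequence of functions admissible for `A n` yields functions admissible for the
union whose norms are arbitrarily close to that of the limit. -/
theorem exists_mem_admissibleGraph_iUnion (hp : 1 < p) {A : ℕ → Set (closure (Ω : Set (RN N)))}
    (hA : Monotone A) {z : ℕ → LpTuple p Ω} (hz : ∀ n, z n ∈ admissibleGraph p Ω (A n))
    {w : LpTuple p Ω} (hw : Tendsto z atTop (𝓝 w)) {ε : ℝ} (hε : 0 < ε) :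
    ∃ y ∈ admissibleGraph p Ω (⋃ n, A n), ‖y‖ ≤ ‖w‖ + ε := by
  have hε4 : 0 < ε / 4 := by linarith
  -- Strict monotonicity of `σ` is not needed: `n ≤ σ n` gives `A n ⊆ A (σ n)`. The rate makes the
  -- increments sum to at most `ε / 2` and puts `z (σ 0)` within `ε / 8` of `w`.
  obtain ⟨σ, hσ, hσw⟩ : ∃ σ : ℕ → ℕ, (∀ n, n ≤ σ n) ∧
      ∀ n, ‖z (σ n) - w‖ ≤ ε / 4 / 2 / 2 ^ n := by
    have h : ∀ n : ℕ, ∃ k, n ≤ k ∧ ‖z k - w‖ ≤ ε / 4 / 2 / 2 ^ n := fun n => by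
      have hpos : 0 < ε / 4 / 2 / 2 ^ n := by positivity
      obtain ⟨k, hk, hkn⟩ := (((tendsto_iff_norm_sub_tendsto_zero.mp hw).eventually
        (ge_mem_nhds hpos)).and (eventually_ge_atTop n)).exists
      exact ⟨k, hkn, hk⟩
    choose σ h1 h2 using h
    exact ⟨σ, h1, h2⟩
  have hdiff : ∀ n, ‖z (σ (n + 1)) - z (σ n)‖ ≤ ε / 2 / 2 / 2 ^ n := by
    intro n
    have h1 := hσw n
    have h2 : ε / 4 / 2 / 2 ^ (n + 1) ≤ ε / 4 / 2 / 2 ^ n := by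
      gcongr <;> norm_num
    have h3 := hσw (n + 1)
    calc ‖z (σ (n + 1)) - z (σ n)‖ = ‖(z (σ (n + 1)) - w) - (z (σ n) - w)‖ := by congr 1; abel
      _ ≤ ‖z (σ (n + 1)) - w‖ + ‖z (σ n) - w‖ := norm_sub_le _ _
      _ ≤ ε / 4 / 2 / 2 ^ n + ε / 4 / 2 / 2 ^ n := by linarith
      _ = ε / 2 / 2 / 2 ^ n := by ring
  choose d hdT hda hdn using fun n =>
    exists_abs_mem hp (sub_mem (hz (σ (n + 1))).1 (hz (σ n)).1)
  have hdle : ∀ n, ‖d n‖ ≤ ε / 2 / 2 / 2 ^ n := fun n => (hdn n).trans (hdiff n)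
  have hgeom : HasSum (fun n : ℕ => ε / 2 / 2 / 2 ^ n) (ε / 2) := hasSum_geometric_two' (ε / 2)
  have hsum : Summable d := Summable.of_norm_bounded hgeom.summable hdle
  have hT : ∑' n, d n ∈ sobolevGraphTilde p Ω :=
    isClosed_sobolevGraphTilde.mem_of_tendsto hsum.hasSum
      (Eventually.of_forall fun s => sum_mem fun n _ => hdT n)
  let π : LpTuple p Ω →L[ℝ] LpOn p Ω := PiLp.proj _ (fun _ : Option (Fin N) => LpOn p Ω) none
  have hπ : HasSum (fun n => |z (σ (n + 1)) none - z (σ n) none|) ((∑' n, d n) none) := by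
    have h := π.hasSum hsum.hasSum
    refine h.congr_fun ?_
    exact fun n => (hda n).symm
  -- By telescoping, `y` dominates every `z (σ m)`, so it is at least 1 on the union of all their
  -- neighbourhoods.
  let y : LpTuple p Ω := z (σ 0) + ∑' n, d n
  have hpart : ∀ m, z (σ m) none ≤ z (σ 0) none +
      ∑ n ∈ Finset.range m, |z (σ (n + 1)) none - z (σ n) none| := by
    intro m
    induction m with
    | zero => simp
    | succ m ih =>
      rw [Finset.sum_range_succ, ← add_assoc]
      calc z (σ (m + 1)) none = z (σ m) none + (z (σ (m + 1)) none - z (σ m) none) := by abel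
        _ ≤ _ := add_le_add ih (le_abs_self _)
  have hle : ∀ m, z (σ m) none ≤ y none := fun m =>
    (hpart m).trans (add_le_add le_rfl (sum_le_hasSum _ (fun n _ => abs_nonneg _) hπ))
  choose hzT O hO hAO hO1 using hz
  refine ⟨y, ⟨add_mem (hzT _) hT, ⋃ m, O (σ m), isOpen_iUnion fun m => hO _,
    Set.iUnion_mono fun m => (hA (hσ m)).trans (hAO _), ?_⟩, ?_⟩
  · have h1 : ∀ᵐ t ∂(volume.restrict (Ω : Set (RN N))), ∀ m, z (σ m) none t ≤ y none t :=
      ae_all_iff.mpr fun m => (Lp.coeFn_le _ _).mpr (hle m)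
    filter_upwards [h1, ae_all_iff.mpr hO1] with t ht1 ht2
    rintro ⟨s, hs, rfl⟩
    obtain ⟨m, hm⟩ := Set.mem_iUnion.mp hs
    exact (ht2 (σ m) ⟨s, hm, rfl⟩).trans (ht1 m)
  · have h0 := hσw 0
    have h1 : ‖∑' n, d n‖ ≤ ε / 2 := tsum_of_norm_bounded hgeom hdle
    have h2 : ‖z (σ 0)‖ ≤ ‖w‖ + ‖z (σ 0) - w‖ := norm_le_norm_add_norm_sub' _ _
    have h3 : ‖y‖ ≤ ‖z (σ 0)‖ + ‖∑' n, d n‖ := norm_add_le _ _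
    norm_num at h0
    linarith

theorem relCap_tendsto_iUnion (hp : 1 < p) {A : ℕ → Set (closure (Ω : Set (RN N)))}
    (hA : Monotone A) :
    Tendsto (fun n => relCap p Ω (A n)) atTop (𝓝 (relCap p Ω (⋃ n, A n))) := by
  have hp0 : 0 < p := by linarith
  refine tendsto_order.mpr ⟨fun c hc => ?_, fun c hc => Eventually.of_forall fun n =>
    (relCap_mono hp.le (Set.subset_iUnion A n)).trans_lt hc⟩
  suffices h : ∃ n, c < relCap p Ω (A n) by
    obtain ⟨n, hn⟩ := h
    filter_upwards [eventually_ge_atTop n] with m hm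
    exact hn.trans_le (relCap_mono hp.le (hA hm))
  by_contra! hle
  refine hc.not_ge ?_
  -- The capacity of the union may be `⊤`, but `c` lies strictly below it and above nonnegative
  -- capacities, so it is real.
  obtain ⟨c, rfl⟩ : ∃ c' : ℝ, c = c' := by
    refine ⟨c.toReal, (EReal.coe_toReal (ne_top_of_lt hc) ?_).symm⟩
    rintro rfl
    exact absurd ((relCap_nonneg hp.le (A 0)).trans (hle 0)) (by simp)
  have hc0 : 0 ≤ c := EReal.coe_nonneg.mp ((relCap_nonneg hp.le (A 0)).trans (hle 0))
  have hrp : (c ^ (1 / p)) ^ p = c := by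
    rw [← Real.rpow_mul hc0, one_div_mul_cancel hp0.ne', Real.rpow_one]
  set r := c ^ (1 / p) with hr
  have hr0 : 0 ≤ r := by positivity
  obtain ⟨z, w, hz, hzw, hwr⟩ := (uniformlyConvexPow_piLp
      (ι := Option (Fin N)) (volume.restrict (Ω : Set (RN N))) hp).exists_tendsto hp
    (K := fun n => admissibleGraph p Ω (A n)) (fun m n hmn => admissibleGraph_anti (hA hmn))
    (fun n => convex_admissibleGraph _) hr0 (fun n ε hε => by
      have hlt : relCap p Ω (A n) < (((r + ε) ^ p : ℝ) : EReal) := by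
        refine (hle n).trans_lt (EReal.coe_lt_coe_iff.mpr ?_)
        rw [← hrp]
        exact Real.rpow_lt_rpow hr0 (by linarith) hp0
      obtain ⟨x, hx, hxlt⟩ := exists_of_relCap_lt hp.le hlt
      exact ⟨x, hx, ((Real.rpow_lt_rpow_iff (norm_nonneg _) (by positivity) hp0).mp
        (EReal.coe_lt_coe_iff.mp hxlt)).le⟩)
  -- The union has capacity at most `(r + ε) ^ p` for every `ε > 0`; letting `ε → 0` gives `c`.
  have ht : Tendsto (fun ε : ℝ => (((r + ε) ^ p : ℝ) : EReal)) (𝓝[>] 0) (𝓝 (c : EReal)) := by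
    have hcont : Continuous fun ε : ℝ => (((r + ε) ^ p : ℝ) : EReal) :=
      continuous_coe_real_ereal.comp
        ((Real.continuous_rpow_const hp0.le).comp (continuous_const.add continuous_id))
    have := (hcont.tendsto 0).mono_left (nhdsWithin_le_nhds (s := Set.Ioi 0))
    rwa [add_zero, hrp] at this
  refine ge_of_tendsto ht ?_
  filter_upwards [self_mem_nhdsWithin] with ε hε
  obtain ⟨y, hy, hyn⟩ := exists_mem_admissibleGraph_iUnion hp hA hz hzw hε
  refine (relCap_le hp.le hy).trans (EReal.coe_le_coe_iff.mpr ?_)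
  exact Real.rpow_le_rpow (norm_nonneg _) (by linarith) hp0.le

end Capacity

end RelCap

theorem mainTheorem2 (N : ℕ) (p : ℝ) (hp : 1 < p) (Ω : TopologicalSpace.Opens (RelCap.RN N)) :
    RelCap.IsNormedChoquetCapacity (RelCap.relCap p Ω) ∧
      ∀ A : Set (closure (Ω : Set (RelCap.RN N))),
        RelCap.relCap p Ω A =
          sInf (RelCap.relCap p Ω ''
            {O : Set (closure (Ω : Set (RelCap.RN N))) | IsOpen O ∧ A ⊆ O}) := by
  have : Fact (1 ≤ ENNReal.ofReal p) := ⟨by simpa using ENNReal.ofReal_le_ofReal hp.le⟩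
  exact ⟨{  mono := fun _ _ h => RelCap.relCap_mono hp.le h
            tendsto_iUnion := fun _ h => RelCap.relCap_tendsto_iUnion hp (monotone_nat_of_le_succ h)
            tendsto_iInter := fun _ h hc =>
              RelCap.relCap_tendsto_iInter hp.le (antitone_nat_of_succ_le h) hc
            empty := RelCap.relCap_empty hp.le },
    RelCap.relCap_eq_sInf_open hp.le⟩
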